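/- Let $a,b>0$ be real, and let $$\Phi_{a,b}(z)={}_1F_1(a;a+b;z)=\sum_{k\ge 0}\frac{(a)_k}{(a+b)_k}\frac{z^k}{k!},\qquad z\in\mathbb{C},$$ be the Kummer function. It has a countably infinite set of complex zeros; let $z_1,z_2,\dots$ be any enumeration of them (all zeros are simple, so each is listed once). Define the hypergeometric zeta function by $$\zeta^H_{a,b}(s)=\sum_{k=1}^\infty \frac{1}{z_k^{s}},$$ a series which converges absolutely for every integer $s=j\ge 2$. Let $\Gamma_1,\Gamma_2,\dots$ be independent random variables, each exponentially distributed with density $e^{-x}$ on $[0,\infty)$, and let $$\mathfrak{Z}_{a,b}=-\frac{a}{a+b}+\sum_{k=1}^\infty\frac{\Gamma_k-1}{z_k},$$ where the series (the limit of its partial sums in the order of the enumeration) converges almost surely. All moments of the complex random variable $\mathfrak{Z}_{a,b}$ are finite; the hypergeometric Bernoulli numbers are $B_n^{(a,b)}=\mathbb{E}\,\mathfrak{Z}_{a,b}^{\,n}$, $n\ge 0$. Then for every integer $n\ge 1$, $$(n-1)!\sum_{j=2}^{n}\frac{B_{n-j}^{(a,b)}}{(n-j)!}\,\zeta^H_{a,b}(j)=\frac{a}{a+b}\,B_{n-1}^{(a,b)}+B_n^{(a,b)}$$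 (the sum being empty for $n=1$). -/

import Mathlib

open scoped Nat
open MeasureTheory ProbabilityTheory

noncomputable section

/-- The Kummer function `M(a,c;z) = ∑ₖ (a)ₖ / (c)ₖ * zᵏ / k!`, where `(x)ₖ = x (x+1) ⋯ (x+k-1)`. -/
def kummerM (a c z : ℂ) : ℂ :=
  ∑' k : ℕ, (ascPochhammer ℂ k).eval a / (ascPochhammer ℂ k).eval c * (z ^ k / (k ! : ℂ))

/-- `Φ_{a,b}(z) = M(a, a+b; z)`. -/
def kummerPhi (a b : ℝ) (z : ℂ) : ℂ :=
  kummerM (a : ℂ) ((a : ℂ) + (b : ℂ)) z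

/-- The set of complex zeros of `Φ_{a,b}`. For `a, b > 0` all of them are simple (`Φ_{a,b}` solves
a second order linear differential equation that is regular away from `0`, and `Φ_{a,b}(0) = 1`),
so listing each zero once is the same as listing the zeros with multiplicity. -/
def kummerZeros (a b : ℝ) : Set ℂ :=
  {w : ℂ | kummerPhi a b w = 0}

/-- The hypergeometric zeta function: the sum of `1 / w ^ s` over the zeros `w` of `Φ_{a,b}`
(principal branch of the power; only integers `s = j ≥ 2` occur below). -/
def hypergeometricZeta (a b : ℝ) (s : ℂ) : ℂ :=
  ∑' w : kummerZeros a b, 1 / (w : ℂ) ^ s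

/-- The complex random variable `𝔷_{a,b} = -a/(a+b) + ∑ₖ (Γₖ - 1) / zₖ`, where `z₀, z₁, …` is an
enumeration of the zeros of `Φ_{a,b}`. The series converges only conditionally, so it is
summed in the order of the enumeration, as the limit of its partial sums. -/
def kummerZ {Ω : Type*} (a b : ℝ) (z : ℕ ≃ kummerZeros a b) (G : ℕ → Ω → ℝ) (ω : Ω) : ℂ :=
  -((a : ℂ) / ((a : ℂ) + (b : ℂ))) +
    ∑'[SummationFilter.conditional ℕ] k : ℕ, ((G k ω : ℂ) - 1) / (z k : ℂ)

/-- The hypergeometric Bernoulli number `B_n^{(a,b)} = 𝔼 [𝔷_{a,b} ^ n]`. -/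
def hypergeometricBernoulli {Ω : Type*} [MeasurableSpace Ω] (P : Measure Ω) (a b : ℝ)
    (z : ℕ ≃ kummerZeros a b) (G : ℕ → Ω → ℝ) (n : ℕ) : ℂ :=
  ∫ ω, kummerZ a b z G ω ^ n ∂P

end

/-! Put `c k = 1 / z k`, `s = -a / (a + b)`, and let `Z_N = s + ∑ k < N, (Γ_k - 1) * c k`. By
independence the exponential generating series of the moments of `Z_N` is the product of `exp (s t)`
and the factors `exp (-c k t) / (1 - c k t)`. Its logarithmic derivative is therefore `s + ∑ j ≥ 1,
(∑ k < N, c k ^ (j + 1)) t ^ j`, and comparing coefficients gives the recurrence for `Z_N` with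
truncated zeta values (`moment_partialSum_succ`).

The limit `N → ∞` needs only `∑ ‖c k‖ ^ 2 < ∞`: the power sums then converge, the recurrence itself
bounds all moments uniformly in `N`, martingale convergence gives `Z_N → 𝔷` almost surely, and
boundedness in `L²` carries the moments to the limit (`tendsto_integral_of_sq_bounded`).

The Kummer function enters through two facts. Since `‖Φ z‖ ≤ exp ‖z‖`, Jensen's inequality bounds
the number of zeros in a disc linearly in the radius, so `∑ 1 / ‖z k‖ ^ 2` converges. With finitely
many zeros, `Φ` would be a polynomial times `exp (α z + β)`; its lower bounds on the two half-axes,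
related by Kummer's transformation, force incompatible values of `α.re`. -/

/-! ### Zeros of entire functions of exponential type -/

/-- An entire function without zeros whose modulus is at most `exp (A + B * ‖z‖)` is the
exponential of an affine function. -/
theorem exists_eq_exp_affine_of_norm_le {g : ℂ → ℂ} (hg : Differentiable ℂ g)
    (h0 : ∀ z, g z ≠ 0) {A B : ℝ} (hA : 0 < A) (hB : 0 ≤ B)
    (hle : ∀ z, ‖g z‖ ≤ Real.exp (A + B * ‖z‖)) :
    ∃ α β : ℂ, ∀ z, g z = Complex.exp (α * z + β) := by
  have hd : Differentiable ℂ (fun z => deriv g z / g z) :=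
    hg.deriv.fun_div hg h0
  obtain ⟨h, hh0, hh⟩ : ∃ h : ℂ → ℂ, Complex.exp (h 0) = g 0 ∧
      ∀ z, HasDerivAt h (deriv g z / g z) z := by
    -- A primitive of `g' / g`, normalised at `0`: a global logarithm of `g`.
    refine ⟨fun z => Complex.wedgeIntegral 0 z (fun z => deriv g z / g z) + Complex.log (g 0)
      - Complex.wedgeIntegral 0 0 (fun z => deriv g z / g z), ?_, fun z => ?_⟩
    · simp [Complex.exp_log (h0 0)]
    · have hz : z ∈ Metric.ball (0 : ℂ) (‖z‖ + 1) := by simp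
      exact ((Complex.IsConservativeOn.hasDerivAt_wedgeIntegral hd.continuous.continuousOn hz
        hd.differentiableOn.isConservativeOn).add_const _).sub_const _
  have hhd : Differentiable ℂ h := fun z => (hh z).differentiableAt
  have hexp : ∀ z, g z = Complex.exp (h z) := by
    have key : ∀ z, g z * Complex.exp (-h z) = g 0 * Complex.exp (-h 0) := by
      intro z
      refine is_const_of_deriv_eq_zero (f := fun z => g z * Complex.exp (-h z))
        (by fun_prop) (fun w => ?_) z 0
      have := (hg w).hasDerivAt.mul ((hh w).neg.cexp)
      refine HasDerivAt.deriv (this.congr_deriv ?_)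
      field_simp [h0 w]
      ring
    intro z
    have hz := key z
    rw [← hh0, ← Complex.exp_add, add_neg_cancel, Complex.exp_zero, Complex.exp_neg] at hz
    exact eq_of_div_eq_one (by simpa [div_eq_mul_inv] using hz)
  have hre : ∀ z, (h z).re ≤ A + B * ‖z‖ := by
    intro z
    have := hle z
    rw [hexp, Complex.norm_exp] at this
    exact Real.exp_le_exp.mp this
  obtain ⟨C, D, hC, hD, hgrow⟩ : ∃ C D : ℝ, 0 ≤ C ∧ 0 ≤ D ∧ ∀ z, ‖h z‖ ≤ C + D * ‖z‖ := by
    refine ⟨2 * (A + 2 * B) + 3 * ‖h 0‖, 4 * B, by positivity, by positivity, fun z => ?_⟩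
    -- A radius proportional to `‖z‖` keeps the quotients in the Borel–Carathéodory bound bounded,
    -- so `h` grows linearly.
    have hz : z ∈ Metric.ball (0 : ℂ) (2 * ‖z‖ + 2) := by
      simp only [mem_ball_zero_iff]; linarith [norm_nonneg z]
    have hM : 0 < A + B * (2 * ‖z‖ + 2) := by positivity
    have hmaps : Set.MapsTo h (Metric.ball 0 (2 * ‖z‖ + 2)) {w | w.re ≤ A + B * (2 * ‖z‖ + 2)} := by
      intro w hw
      rw [mem_ball_zero_iff] at hw
      have := hre w
      have h2 := mul_le_mul_of_nonneg_left hw.le hB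
      simp only [Set.mem_ofPred_eq]
      linarith
    have hbc := Complex.borelCaratheodory hM hhd.differentiableOn hmaps (by positivity) hz
    refine hbc.trans ?_
    have hden : 0 < 2 * ‖z‖ + 2 - ‖z‖ := by linarith [norm_nonneg z]
    have h1 : 2 * (A + B * (2 * ‖z‖ + 2)) * ‖z‖ / (2 * ‖z‖ + 2 - ‖z‖)
        ≤ 2 * (A + B * (2 * ‖z‖ + 2)) := by
      rw [div_le_iff₀ hden]
      exact mul_le_mul_of_nonneg_left (by linarith) (by positivity)
    have h2 : ‖h 0‖ * (2 * ‖z‖ + 2 + ‖z‖) / (2 * ‖z‖ + 2 - ‖z‖) ≤ ‖h 0‖ * 3 := by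
      rw [div_le_iff₀ hden, mul_assoc]
      exact mul_le_mul_of_nonneg_left (by linarith) (by positivity)
    linarith
  have hderiv : ∀ z, ‖deriv h z‖ ≤ C + 2 * D := by
    intro z
    -- Cauchy's estimate on a circle of radius `‖z‖ + 1` bounds `deriv h`; Liouville's theorem then
    -- makes it constant.
    have hR : 0 < ‖z‖ + 1 := by positivity
    have := Complex.norm_deriv_le_of_forall_mem_sphere_norm_le (f := h) (c := z)
      (C := C + D * (2 * ‖z‖ + 1)) hR hhd.diffContOnCl
      (fun w hw => (hgrow w).trans (by
        have : ‖w‖ ≤ 2 * ‖z‖ + 1 := by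
          have h3 : ‖w - z‖ = ‖z‖ + 1 := by simpa [dist_eq_norm] using hw
          have := norm_le_norm_sub_add w z
          linarith
        gcongr))
    refine this.trans ?_
    rw [div_le_iff₀ hR]
    nlinarith [norm_nonneg z, mul_nonneg hC (norm_nonneg z)]
  have hconst : ∀ z, deriv h z = deriv h 0 := fun z =>
    hhd.deriv.apply_eq_apply_of_bounded
      (isBounded_iff_forall_norm_le.mpr ⟨C + 2 * D, by rintro _ ⟨w, rfl⟩; exact hderiv w⟩) z 0
  refine ⟨deriv h 0, h 0, fun z => ?_⟩
  have := is_const_of_deriv_eq_zero (f := fun z => h z - deriv h 0 * z) (by fun_prop)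
    (fun w => by
      have h1 := ((hhd w).hasDerivAt.sub ((hasDerivAt_id w).const_mul (deriv h 0)))
      refine HasDerivAt.deriv (h1.congr_deriv ?_)
      rw [hconst w]; simp) z 0
  rw [hexp z]
  congr 1
  simp only [mul_zero, sub_zero] at this
  rw [← this]; ring

/-- A nonzero entire function with finitely many zeros is the product of an entire function
without zeros and of a factor which is at least `1` in modulus near infinity and grows more slowly
than every exponential. -/
theorem exists_eq_mul_of_finite_zeros (S : Finset ℂ) : ∀ f : ℂ → ℂ, Differentiable ℂ f →
    (∃ z, f z ≠ 0) → (∀ z, f z = 0 → z ∈ S) →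
    ∃ p g : ℂ → ℂ, Differentiable ℂ g ∧ (∀ z, g z ≠ 0) ∧ (∀ z, f z = p z * g z) ∧
      (∃ R : ℝ, ∀ z, R ≤ ‖z‖ → 1 ≤ ‖p z‖) ∧
      ∀ ε : ℝ, 0 < ε → ∃ C : ℝ, 0 < C ∧ ∀ z, ‖p z‖ ≤ C * Real.exp (ε * ‖z‖) := by
  induction S using Finset.induction_on with
  | empty =>
    intro f hf _ hS
    refine ⟨fun _ => 1, f, hf, fun z hz => by simpa using hS z hz, by simp, ⟨0, by simp⟩,
      fun ε hε => ⟨1, one_pos, fun z => ?_⟩⟩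
    simp only [norm_one, one_mul]
    exact Real.one_le_exp (by positivity)
  | insert w S hw ih =>
    intro f hf hne hS
    obtain ⟨q, hq⟩ := hf.analyticAt w
    have hq0 : q ≠ 0 := by
      rintro rfl
      have h0 : f =ᶠ[nhds w] 0 := hq.eventually_eq_zero
      have : f = 0 := AnalyticOnNhd.eq_of_eventuallyEq (fun z _ => hf.analyticAt z)
        (fun z _ => analyticAt_const) h0
      obtain ⟨z, hz⟩ := hne
      exact hz (by rw [this]; rfl)
    set n := q.order
    -- Iterating `dslope` divides out the full order of vanishing at `w` and keeps the function
    -- entire.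
    set f' := (Function.swap dslope w)^[n] f with hf'
    have hfac : ∀ z, f z = (z - w) ^ n * f' z := fun z => hq.eq_pow_order_mul_iterate_dslope z
    have hw' : f' w ≠ 0 := hq.iterate_dslope_fslope_ne_zero hq0
    have hd' : Differentiable ℂ f' := by
      have : ∀ m : ℕ, Differentiable ℂ ((Function.swap dslope w)^[m] f) := by
        intro m
        induction m with
        | zero => exact hf
        | succ m ihm =>
          rw [Function.iterate_succ_apply']
          rw [← differentiableOn_univ] at ihm ⊢
          exact (Complex.differentiableOn_dslope Filter.univ_mem).mpr ihm
      exact this n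
    obtain ⟨p, g, hg, hg0, hfg, ⟨R, hR⟩, hp⟩ := ih f' hd' ⟨w, hw'⟩ (fun z hz => by
      have hzS := hS z (by rw [hfac, hz, mul_zero])
      rcases Finset.mem_insert.mp hzS with rfl | h
      · exact absurd hz hw'
      · exact h)
    refine ⟨fun z => (z - w) ^ n * p z, g, hg, hg0, fun z => by rw [hfac, hfg, mul_assoc],
      ⟨max R (‖w‖ + 1), fun z hz => ?_⟩, fun ε hε => ?_⟩
    · rw [norm_mul, norm_pow]
      have h1 : 1 ≤ ‖z - w‖ := by
        have := norm_sub_norm_le z w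
        have := (le_max_right _ _).trans hz
        linarith
      exact one_le_mul_of_one_le_of_one_le (one_le_pow₀ h1) (hR z ((le_max_left _ _).trans hz))
    · obtain ⟨C, hC, hCz⟩ := hp (ε / 2) (by positivity)
      -- Chosen so that `n * δ ≤ ε / 2`: the `n` linear factors use half of the exponent, `p` the
      -- other half.
      set δ := ε / (2 * (n + 1)) with hδ
      have hδ0 : 0 < δ := by positivity
      refine ⟨(‖w‖ + δ⁻¹) ^ n * C, by positivity, fun z => ?_⟩
      have h1 : ‖z - w‖ ≤ (‖w‖ + δ⁻¹) * Real.exp (δ * ‖z‖) := by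
        have h2 : 1 + δ * ‖z‖ ≤ Real.exp (δ * ‖z‖) := by
          linarith [Real.add_one_le_exp (δ * ‖z‖)]
        have h3 : δ⁻¹ * (δ * ‖z‖) = ‖z‖ := by field_simp
        calc ‖z - w‖ ≤ ‖z‖ + ‖w‖ := norm_sub_le _ _
          _ ≤ (‖w‖ + δ⁻¹) * (1 + δ * ‖z‖) := by
            have : 0 ≤ ‖w‖ * (δ * ‖z‖) := by positivity
            have : 0 < δ⁻¹ := by positivity
            nlinarith
          _ ≤ _ := by gcongr
      calc ‖(z - w) ^ n * p z‖ = ‖z - w‖ ^ n * ‖p z‖ := by rw [norm_mul, norm_pow]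
        _ ≤ ((‖w‖ + δ⁻¹) * Real.exp (δ * ‖z‖)) ^ n * (C * Real.exp (ε / 2 * ‖z‖)) := by
          gcongr
          exact hCz z
        _ = (‖w‖ + δ⁻¹) ^ n * C * Real.exp (n * (δ * ‖z‖) + ε / 2 * ‖z‖) := by
          rw [mul_pow, ← Real.exp_nat_mul, Real.exp_add]; ring
        _ ≤ _ := by
          gcongr
          have h4 : n * δ ≤ ε / 2 := by
            rw [hδ, mul_div_assoc', div_le_div_iff₀ (by positivity) (by positivity)]
            nlinarith
          nlinarith [norm_nonneg z]

/-- An entire function of exponential type which grows at least like `exp (3 * x / 4)` on the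
positive real axis and decays at most like `exp (-x / 4)` on the negative one has infinitely many
zeros: with finitely many it would grow there like a single exponential `exp (α * x)`. -/
theorem infinite_zeros_of_growth {f : ℂ → ℂ} (hf : Differentiable ℂ f)
    (hle : ∀ z, ‖f z‖ ≤ Real.exp ‖z‖) {c : ℝ} (hc : 0 < c)
    (hpos : ∀ x : ℝ, 0 ≤ x → c * Real.exp (3 / 4 * x) ≤ ‖f x‖)
    (hneg : ∀ x : ℝ, 0 ≤ x → c * Real.exp (-(1 / 4) * x) ≤ ‖f (-x)‖) :
    {z | f z = 0}.Infinite := by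
  intro hfin
  have hf0 : f 0 ≠ 0 := by
    have := hpos 0 le_rfl
    intro h
    simp [h] at this
    linarith
  obtain ⟨p, g, hg, hg0, hfg, ⟨R, hR⟩, hp⟩ :=
    exists_eq_mul_of_finite_zeros hfin.toFinset f hf ⟨0, hf0⟩ (fun z hz => by simpa using hz)
  obtain ⟨M, hM⟩ := (isCompact_closedBall (0 : ℂ) R).exists_bound_of_continuousOn
    hg.continuous.continuousOn
  obtain ⟨α, β, hαβ⟩ := exists_eq_exp_affine_of_norm_le hg hg0 (A := |M| + 1) (B := 1)
    (by positivity) zero_le_one (fun z => by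
      rcases le_total R ‖z‖ with h | h
      · have h1 := hR z h
        have h2 : ‖f z‖ = ‖p z‖ * ‖g z‖ := by rw [hfg, norm_mul]
        have h3 : ‖g z‖ ≤ ‖f z‖ := by rw [h2]; exact le_mul_of_one_le_left (norm_nonneg _) h1
        refine (h3.trans (hle z)).trans (Real.exp_le_exp.mpr ?_)
        have := abs_nonneg M
        linarith
      · have h1 := hM z (by simpa using h)
        have h2 := Real.add_one_le_exp (|M| + 1 + 1 * ‖z‖)
        have := le_abs_self M
        have := norm_nonneg z
        linarith)
  -- With loss `1 / 8` the two half-axes give `α.re ≥ 3/4 - 1/8` and `α.re ≤ 1/4 + 1/8`, which is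
  -- contradictory.
  obtain ⟨C, hC, hCz⟩ := hp (1 / 8) (by norm_num)
  have hup : ∀ z, ‖f z‖ ≤ C * Real.exp (1 / 8 * ‖z‖) * Real.exp ((α * z).re + β.re) := by
    intro z
    rw [hfg, norm_mul, hαβ, Complex.norm_exp, Complex.add_re]
    gcongr
    exact hCz z
  have hlog : ∀ (t : ℝ), 0 < t → ¬ ∀ x : ℝ, 0 ≤ x → c * Real.exp (t * x) ≤ C * Real.exp β.re := by
    intro t ht H
    have h1 := H (C * Real.exp β.re / (c * t)) (by positivity)
    have h2 := Real.add_one_le_exp (t * (C * Real.exp β.re / (c * t)))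
    have h3 : c * (t * (C * Real.exp β.re / (c * t))) = C * Real.exp β.re := by field_simp
    nlinarith
  have h58 : 5 / 8 ≤ α.re := by
    by_contra! hlt
    refine hlog (5 / 8 - α.re) (by linarith) (fun x hx => ?_)
    have h1 := (hpos x hx).trans (hup x)
    have h2 : (α * (x : ℂ)).re = α.re * x := by simp
    rw [h2, Complex.norm_real, Real.norm_of_nonneg hx] at h1
    have h3 : c * Real.exp ((5 / 8 - α.re) * x)
        = c * Real.exp (3 / 4 * x) * Real.exp (-(1 / 8 + α.re) * x) := by
      rw [mul_assoc, ← Real.exp_add]; ring_nf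
    have h4 : C * Real.exp β.re = C * Real.exp (1 / 8 * x) * Real.exp (α.re * x + β.re) *
        Real.exp (-(1 / 8 + α.re) * x) := by
      rw [mul_assoc, mul_assoc, ← Real.exp_add, ← Real.exp_add]; ring_nf
    rw [h3, h4]
    gcongr
  have h38 : α.re ≤ 3 / 8 := by
    by_contra! hlt
    refine hlog (α.re - 3 / 8) (by linarith) (fun x hx => ?_)
    have h1 := (hneg x hx).trans (hup (-x))
    have h2 : (α * (-x : ℂ)).re = -α.re * x := by simp
    rw [h2, norm_neg, Complex.norm_real, Real.norm_of_nonneg hx] at h1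
    have h3 : c * Real.exp ((α.re - 3 / 8) * x)
        = c * Real.exp (-(1 / 4) * x) * Real.exp ((α.re - 1 / 8) * x) := by
      rw [mul_assoc, ← Real.exp_add]; ring_nf
    have h4 : C * Real.exp β.re = C * Real.exp (1 / 8 * x) * Real.exp (-α.re * x + β.re) *
        Real.exp ((α.re - 1 / 8) * x) := by
      rw [mul_assoc, mul_assoc, ← Real.exp_add, ← Real.exp_add]; ring_nf
    rw [h3, h4]
    gcongr
  linarith

/-- By Jensen's inequality, an entire function of exponential type `1` with `f 0 = 1` has at most
`3 * r` zeros in the disc of radius `r`. -/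
theorem card_zeros_le {f : ℂ → ℂ} (hf : Differentiable ℂ f) (h0 : f 0 = 1)
    (hle : ∀ z, ‖f z‖ ≤ Real.exp ‖z‖) {r : ℝ} (hr : 0 < r) (s : Finset ℂ)
    (hs : ∀ w ∈ s, f w = 0 ∧ ‖w‖ ≤ r) : (s.card : ℝ) ≤ 3 * r := by
  have hR : 0 < Real.exp 1 * r := by positivity
  have he : 1 < Real.exp 1 := by simp
  have hlt : |r| < |Real.exp 1 * r| := by
    rw [abs_of_pos hr, abs_of_pos hR]
    nlinarith
  have hA : ∀ t : ℝ, AnalyticOnNhd ℂ f (Metric.closedBall 0 t) := fun t z _ => hf.analyticAt z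
  -- The outer radius `e * r` makes `log (R / r) = 1`, so Jensen's bound is `e * r ≤ 3 * r`.
  have hJ := AnalyticOnNhd.sum_divisor_le (c := 0) (r := r) (R := Real.exp 1 * r)
    (M := Real.exp (Real.exp 1 * r)) (by positivity) hlt (Real.one_le_exp hR.le) (hA _)
    (by rw [h0]; exact one_ne_zero) (fun z hz => by
      have : ‖z‖ = Real.exp 1 * r := by simpa [abs_of_pos hR] using hz
      rw [← this]; exact hle z)
  have hval : Real.log (Real.exp (Real.exp 1 * r) / ‖f 0‖) / Real.log (Real.exp 1 * r / r)
      = Real.exp 1 * r := by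
    rw [h0, mul_div_assoc, div_self hr.ne']
    simp
  rw [hval] at hJ
  have hfin : (Function.support
      (MeromorphicOn.divisor f (Metric.closedBall 0 |r|))).Finite :=
    (MeromorphicOn.divisor f _).finiteSupport (isCompact_closedBall ..)
  have hone : ∀ w ∈ s, 1 ≤ MeromorphicOn.divisor f (Metric.closedBall 0 |r|) w := by
    intro w hw
    have hwm : w ∈ Metric.closedBall (0 : ℂ) |r| := by
      simpa [abs_of_pos hr] using (hs w hw).2
    rw [MeromorphicOn.AnalyticOnNhd.divisor_apply (hA _) hwm]
    have hne0 : analyticOrderAt f w ≠ 0 := by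
      rw [ne_eq, (hf.analyticAt w).analyticOrderAt_eq_zero]
      simpa using (hs w hw).1
    have hnetop : analyticOrderAt f w ≠ ⊤ := by
      rw [ne_eq, analyticOrderAt_eq_top]
      intro h
      have : f = 0 := AnalyticOnNhd.eq_of_eventuallyEq (fun z _ => hf.analyticAt z)
        (fun z _ => analyticAt_const) h
      simp [this] at h0
    obtain ⟨n, hn⟩ := ENat.ne_top_iff_exists.mp hnetop
    rw [← hn] at hne0 ⊢
    have : n ≠ 0 := by simpa using hne0
    simp
    omega
  have hnonneg : ∀ w, 0 ≤ MeromorphicOn.divisor f (Metric.closedBall 0 |r|) w :=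
    fun w => (MeromorphicOn.AnalyticOnNhd.divisor_nonneg (hA _)) w
  have hcard : (s.card : ℤ) ≤ ∑ᶠ u, MeromorphicOn.divisor f (Metric.closedBall 0 |r|) u := by
    rw [finsum_eq_sum_of_support_subset _ (s := hfin.toFinset) (by simp)]
    have hsub : s ⊆ hfin.toFinset := by
      intro w hw
      have := hone w hw
      simp only [Set.Finite.mem_toFinset, Function.mem_support]
      omega
    calc (s.card : ℤ) = ∑ w ∈ s, 1 := by simp
      _ ≤ ∑ w ∈ s, MeromorphicOn.divisor f (Metric.closedBall 0 |r|) w := Finset.sum_le_sum hone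
      _ ≤ _ := Finset.sum_le_sum_of_subset_of_nonneg hsub (fun w _ _ => hnonneg w)
  have h3 : ((s.card : ℤ) : ℝ) ≤ Real.exp 1 * r := (Int.cast_le.mpr hcard).trans hJ
  have := Real.exp_one_lt_d9
  push_cast at h3
  nlinarith

/-- If `Z` has at most `3 * r` points in the disc of radius `r` for all `r`, and none of modulus
less than `1 / 2`, then `∑ 1 / ‖w‖ ^ 2` converges over `Z`. -/
theorem summable_inv_norm_sq_of_card_le {Z : Set ℂ} (hhalf : ∀ w ∈ Z, 1 / 2 ≤ ‖w‖)
    (hcard : ∀ r : ℝ, 0 < r → ∀ s : Finset ℂ, (∀ w ∈ s, w ∈ Z ∧ ‖w‖ ≤ r) → (s.card : ℝ) ≤ 3 * r) :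
    Summable (fun w : Z => (‖(w : ℂ)‖ ^ 2)⁻¹) := by
  classical
  have hgeom : Summable (fun k : ℕ => (12 : ℝ) * (1 / 2) ^ k) :=
    summable_geometric_two.mul_left 12
  refine summable_of_sum_le (c := ∑' k : ℕ, (12 : ℝ) * (1 / 2) ^ k)
    (fun w => by positivity) (fun u => ?_)
  -- Dyadic shells: shell `j` has at most `3 * 2 ^ j` points, each contributing at most `4 / 4 ^ j`.
  -- The lower bound `1 / 2` on the moduli handles shell `0`.
  have hk : ∀ w : Z, ∃ k : ℕ, ‖(w : ℂ)‖ ≤ 2 ^ k ∧ (2 : ℝ) ^ k ≤ 2 * ‖(w : ℂ)‖ := by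
    intro w
    have hw := hhalf w w.2
    have hex : ∃ k : ℕ, ‖(w : ℂ)‖ ≤ 2 ^ k :=
      (pow_unbounded_of_one_lt ‖(w : ℂ)‖ one_lt_two).imp fun _ h => h.le
    refine ⟨Nat.find hex, Nat.find_spec hex, ?_⟩
    rcases hj : Nat.find hex with _ | j
    · simp; linarith
    · have := Nat.find_min hex (m := j) (by omega)
      push Not at this
      rw [pow_succ]; linarith
  choose k hk1 hk2 using hk
  have hterm : ∀ w : Z, (‖(w : ℂ)‖ ^ 2)⁻¹ ≤ 4 * (1 / 4) ^ k w := by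
    intro w
    have hw : 0 < ‖(w : ℂ)‖ := by linarith [hhalf w w.2]
    have h1 : ((2 : ℝ) ^ k w) ^ 2 ≤ (2 * ‖(w : ℂ)‖) ^ 2 := by gcongr; exact hk2 w
    have h2 : ((2 : ℝ) ^ k w) ^ 2 = 4 ^ k w := by rw [← pow_mul, mul_comm, pow_mul]; norm_num
    rw [h2] at h1
    rw [one_div, inv_pow, inv_le_iff_one_le_mul₀ (by positivity)]
    field_simp
    linarith
  set N := (u.sup k) + 1
  have hmaps : ∀ w ∈ u, k w ∈ Finset.range N := fun w hw =>
    Finset.mem_range.mpr (Nat.lt_succ_of_le (Finset.le_sup hw))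
  calc ∑ w ∈ u, (‖(w : ℂ)‖ ^ 2)⁻¹ ≤ ∑ w ∈ u, 4 * (1 / 4 : ℝ) ^ k w :=
        Finset.sum_le_sum fun w _ => hterm w
    _ = ∑ j ∈ Finset.range N, ∑ w ∈ u with k w = j, 4 * (1 / 4 : ℝ) ^ k w :=
        (Finset.sum_fiberwise_of_maps_to hmaps _).symm
    _ ≤ ∑ j ∈ Finset.range N, (12 : ℝ) * (1 / 2) ^ j := by
        refine Finset.sum_le_sum fun j _ => ?_
        have h1 : ∑ w ∈ u with k w = j, 4 * (1 / 4 : ℝ) ^ k w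
            = ((u.filter (fun w => k w = j)).card : ℝ) * (4 * (1 / 4 : ℝ) ^ j) := by
          rw [← nsmul_eq_mul, ← Finset.sum_const]
          exact Finset.sum_congr rfl fun w hw => by rw [(Finset.mem_filter.mp hw).2]
        have h2 := hcard (2 ^ j) (by positivity)
          ((u.filter (fun w => k w = j)).map (Function.Embedding.subtype _)) (by
            intro w hw
            obtain ⟨v, hv, rfl⟩ := Finset.mem_map.mp hw
            refine ⟨v.2, ?_⟩
            rw [← (Finset.mem_filter.mp hv).2]
            exact hk1 v)
        rw [Finset.card_map] at h2
        rw [h1]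
        calc _ ≤ 3 * 2 ^ j * (4 * (1 / 4 : ℝ) ^ j) := by gcongr
          _ = 12 * (2 * (1 / 4) : ℝ) ^ j := by rw [mul_pow]; ring
          _ = _ := by norm_num
    _ ≤ _ := hgeom.sum_le_tsum _ (fun j _ => by positivity)

/-! ### Growth and zeros of the Kummer function -/

noncomputable section

/-- The ratio `(a)ₖ / (a + b)ₖ` of rising factorials. -/
def pochhammerRatio (a b : ℝ) (k : ℕ) : ℝ :=
  (ascPochhammer ℝ k).eval a / (ascPochhammer ℝ k).eval (a + b)

end

theorem pochhammerRatio_zero (a b : ℝ) : pochhammerRatio a b 0 = 1 := by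
  simp [pochhammerRatio]

theorem pochhammerRatio_succ (a b : ℝ) (k : ℕ) :
    pochhammerRatio a b (k + 1) = pochhammerRatio a b k * ((a + k) / (a + b + k)) := by
  simp only [pochhammerRatio, ascPochhammer_succ_eval]
  rw [mul_div_mul_comm]

theorem pochhammerRatio_pos {a b : ℝ} (ha : 0 < a) (hb : 0 < b) (k : ℕ) :
    0 < pochhammerRatio a b k :=
  div_pos (ascPochhammer_pos k a ha) (ascPochhammer_pos k _ (by positivity))

theorem pochhammerRatio_antitone {a b : ℝ} (ha : 0 < a) (hb : 0 < b) :
    Antitone (pochhammerRatio a b) := by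
  refine antitone_nat_of_succ_le fun k => ?_
  rw [pochhammerRatio_succ]
  refine mul_le_of_le_one_right (pochhammerRatio_pos ha hb k).le ?_
  rw [div_le_one (by positivity)]
  linarith

theorem pochhammerRatio_le_one {a b : ℝ} (ha : 0 < a) (hb : 0 < b) (k : ℕ) :
    pochhammerRatio a b k ≤ 1 :=
  pochhammerRatio_zero a b ▸ pochhammerRatio_antitone ha hb (Nat.zero_le k)

/-- Consecutive quotients `(a + k) / (a + b + k)` tend to `1` and are at least `3 / 4` once `k ≥ 3 *
b`. The contradiction on the two half-axes needs a rate above `1 / 2`. -/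
theorem exists_pow_le_pochhammerRatio {a b : ℝ} (ha : 0 < a) (hb : 0 < b) :
    ∃ c : ℝ, 0 < c ∧ ∀ k, c * (3 / 4) ^ k ≤ pochhammerRatio a b k := by
  obtain ⟨m, hm⟩ := exists_nat_ge (3 * b)
  refine ⟨pochhammerRatio a b m, pochhammerRatio_pos ha hb m, fun k => ?_⟩
  rcases le_total k m with h | h
  · refine le_trans ?_ (pochhammerRatio_antitone ha hb h)
    exact mul_le_of_le_one_right (pochhammerRatio_pos ha hb m).le
      (pow_le_one₀ (by norm_num) (by norm_num))
  · induction k, h using Nat.le_induction with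
    | base =>
      exact mul_le_of_le_one_right (pochhammerRatio_pos ha hb m).le
        (pow_le_one₀ (by norm_num) (by norm_num))
    | succ k hk ih =>
      rw [pochhammerRatio_succ, pow_succ, ← mul_assoc]
      have : (m : ℝ) ≤ k := by exact_mod_cast hk
      refine mul_le_mul ih ?_ (by norm_num) (pochhammerRatio_pos ha hb k).le
      rw [le_div_iff₀ (by positivity)]
      linarith

theorem ofReal_pochhammerRatio (a b : ℝ) (k : ℕ) :
    ((pochhammerRatio a b k : ℝ) : ℂ) =
      (ascPochhammer ℂ k).eval (a : ℂ) / (ascPochhammer ℂ k).eval ((a : ℂ) + (b : ℂ)) := by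
  have key : ∀ x : ℝ, (((ascPochhammer ℝ k).eval x : ℝ) : ℂ) = (ascPochhammer ℂ k).eval (x : ℂ) := by
    intro x
    induction k with
    | zero => simp
    | succ k ih => simp [ascPochhammer_succ_eval, ih]
  rw [pochhammerRatio, Complex.ofReal_div, key, key, Complex.ofReal_add]

theorem kummerPhi_eq_tsum (a b : ℝ) (z : ℂ) :
    kummerPhi a b z = ∑' k : ℕ, (pochhammerRatio a b k : ℂ) * (z ^ k / (k ! : ℂ)) := by
  simp only [kummerPhi, kummerM, ofReal_pochhammerRatio]

theorem norm_kummer_term_le {a b : ℝ} (ha : 0 < a) (hb : 0 < b) (z : ℂ) (k : ℕ) :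
    ‖(pochhammerRatio a b k : ℂ) * (z ^ k / (k ! : ℂ))‖ ≤ ‖z‖ ^ k / k ! := by
  rw [norm_mul, norm_div, norm_pow, Complex.norm_natCast, Complex.norm_real,
    Real.norm_of_nonneg (pochhammerRatio_pos ha hb k).le]
  exact mul_le_of_le_one_left (by positivity) (pochhammerRatio_le_one ha hb k)

theorem summable_norm_kummer {a b : ℝ} (ha : 0 < a) (hb : 0 < b) (z : ℂ) :
    Summable fun k : ℕ => ‖(pochhammerRatio a b k : ℂ) * (z ^ k / (k ! : ℂ))‖ :=
  Summable.of_nonneg_of_le (fun _ => norm_nonneg _) (norm_kummer_term_le ha hb z)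
    (Real.summable_pow_div_factorial ‖z‖)

theorem norm_kummerPhi_le {a b : ℝ} (ha : 0 < a) (hb : 0 < b) (z : ℂ) :
    ‖kummerPhi a b z‖ ≤ Real.exp ‖z‖ := by
  rw [kummerPhi_eq_tsum, Real.exp_eq_exp_ℝ, NormedSpace.exp_eq_tsum_div]
  exact tsum_of_norm_bounded (Real.summable_pow_div_factorial ‖z‖).hasSum
    (norm_kummer_term_le ha hb z)

theorem kummerPhi_zero (a b : ℝ) : kummerPhi a b 0 = 1 := by
  rw [kummerPhi_eq_tsum, tsum_eq_single 0 (fun k hk => by simp [hk])]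
  simp [pochhammerRatio_zero]

theorem differentiable_kummerPhi {a b : ℝ} (ha : 0 < a) (hb : 0 < b) :
    Differentiable ℂ (kummerPhi a b) := by
  intro z
  have h := Complex.differentiableOn_tsum_of_summable_norm (U := Metric.ball (0 : ℂ) (‖z‖ + 1))
    (F := fun (k : ℕ) (z : ℂ) => (pochhammerRatio a b k : ℂ) * (z ^ k / (k ! : ℂ)))
    (Real.summable_pow_div_factorial (‖z‖ + 1)) (fun k => by fun_prop) Metric.isOpen_ball
    (fun k w hw => (norm_kummer_term_le ha hb w k).trans (by
      have : ‖w‖ ≤ ‖z‖ + 1 := (mem_ball_zero_iff.mp hw).le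
      gcongr))
  simp only [← kummerPhi_eq_tsum] at h
  exact h.differentiableAt (Metric.isOpen_ball.mem_nhds (by simp))

/-- At a zero, the terms of positive degree sum to `-1`, yet they are dominated by `exp ‖z‖ - 1 < 1`
when `‖z‖ < 1 / 2`. -/
theorem half_le_norm_of_kummerPhi_eq_zero {a b : ℝ} (ha : 0 < a) (hb : 0 < b) {z : ℂ}
    (hz : kummerPhi a b z = 0) : 1 / 2 ≤ ‖z‖ := by
  by_contra! hlt
  have hs := (summable_norm_kummer ha hb z).of_norm
  rw [kummerPhi_eq_tsum, hs.tsum_eq_zero_add] at hz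
  have h1 : ‖∑' k : ℕ, (pochhammerRatio a b (k + 1) : ℂ) * (z ^ (k + 1) / ((k + 1)! : ℂ))‖
      ≤ Real.exp ‖z‖ - 1 := by
    have he := (NormedSpace.expSeries_div_hasSum_exp ‖z‖)
    rw [← Real.exp_eq_exp_ℝ, ← hasSum_nat_add_iff' 1] at he
    exact tsum_of_norm_bounded (by simpa using he)
      (fun k => norm_kummer_term_le ha hb z (k + 1))
  have h2 : ∑' k : ℕ, (pochhammerRatio a b (k + 1) : ℂ) * (z ^ (k + 1) / ((k + 1)! : ℂ)) = -1 := by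
    simp only [pochhammerRatio_zero] at hz
    simp at hz
    linear_combination hz
  rw [h2, norm_neg, norm_one] at h1
  have h3 : Real.exp ‖z‖ < 2 := by
    have h4 : Real.exp ‖z‖ ^ 2 < 2 ^ 2 := by
      rw [← Real.exp_nat_mul]
      calc Real.exp ((2 : ℕ) * ‖z‖) < Real.exp 1 := by
            apply Real.exp_lt_exp.mpr; push_cast; linarith
        _ < 2 ^ 2 := by linarith [Real.exp_one_lt_d9]
    exact lt_of_pow_lt_pow_left₀ 2 (by norm_num) h4
  linarith

/-- The Chu–Vandermonde identity as an iterated difference. -/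
theorem sum_choose_mul_pochhammer_div {b c : ℝ} (hc : 0 < c) (k : ℕ) : ∀ m : ℕ,
    ∑ j ∈ Finset.range (k + 1), (k.choose j : ℝ) * (-1) ^ j *
      ((ascPochhammer ℝ (m + j)).eval b / (ascPochhammer ℝ (m + j)).eval c) =
      (ascPochhammer ℝ m).eval b * (ascPochhammer ℝ k).eval (c - b) /
        (ascPochhammer ℝ (m + k)).eval c := by
  induction k with
  | zero => intro m; simp
  | succ k ih =>
    intro m
    set u : ℕ → ℝ := fun j => (ascPochhammer ℝ j).eval b / (ascPochhammer ℝ j).eval c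
    -- Pascal's rule: the difference of order `k + 1` at `m` is that of order `k` at `m` minus that
    -- at `m + 1`, hence the general offset `m`.
    have hstep : ∑ j ∈ Finset.range (k + 1 + 1), ((k + 1).choose j : ℝ) * (-1) ^ j * u (m + j) =
        ∑ j ∈ Finset.range (k + 1), (k.choose j : ℝ) * (-1) ^ j * u (m + j) -
        ∑ j ∈ Finset.range (k + 1), (k.choose j : ℝ) * (-1) ^ j * u (m + 1 + j) := by
      rw [Finset.sum_range_succ' _ (k + 1)]
      have h1 : ∀ j, ((k + 1).choose (j + 1) : ℝ) * (-1) ^ (j + 1) * u (m + (j + 1)) =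
          (k.choose (j + 1) : ℝ) * (-1) ^ (j + 1) * u (m + (j + 1)) -
            (k.choose j : ℝ) * (-1) ^ j * u (m + 1 + j) := by
        intro j
        rw [Nat.choose_succ_succ, show m + 1 + j = m + (j + 1) by ring]
        push_cast; ring
      simp only [h1, Finset.sum_sub_distrib]
      have h2 := Finset.sum_range_succ' (fun j => (k.choose j : ℝ) * (-1) ^ j * u (m + j)) (k + 1)
      rw [Finset.sum_range_succ _ (k + 1)] at h2
      simp only [Nat.choose_succ_self, Nat.cast_zero, zero_mul, add_zero, Nat.choose_zero_right,
        pow_zero] at h2 ⊢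
      rw [h2]; ring
    rw [hstep, ih m, ih (m + 1), show m + 1 + k = m + k + 1 by ring,
      show m + (k + 1) = m + k + 1 by ring]
    simp only [ascPochhammer_succ_eval]
    have h1 : (ascPochhammer ℝ (m + k)).eval c ≠ 0 := (ascPochhammer_pos _ _ hc).ne'
    have h2 : c + ((m + k : ℕ) : ℝ) ≠ 0 := by positivity
    field_simp
    push_cast
    ring

/-- Kummer's transformation. -/
theorem kummerPhi_eq_exp_mul {a b : ℝ} (ha : 0 < a) (hb : 0 < b) (z : ℂ) :
    kummerPhi a b z = Complex.exp z * kummerPhi b a (-z) := by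
  have hexp : Complex.exp z = ∑' k : ℕ, z ^ k / (k ! : ℂ) := by
    rw [Complex.exp_eq_exp_ℂ, NormedSpace.exp_eq_tsum_div]
  have hs : Summable fun k : ℕ => ‖z ^ k / (k ! : ℂ)‖ := by
    simpa using Real.summable_pow_div_factorial ‖z‖
  rw [mul_comm, hexp, kummerPhi_eq_tsum, kummerPhi_eq_tsum,
    tsum_mul_tsum_eq_tsum_sum_antidiagonal_of_summable_norm (summable_norm_kummer hb ha (-z)) hs]
  refine tsum_congr fun k => ?_
  rw [Finset.Nat.sum_antidiagonal_eq_sum_range_succ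
    (fun i j => (pochhammerRatio b a i : ℂ) * ((-z) ^ i / (i ! : ℂ)) * (z ^ j / (j ! : ℂ)))]
  -- The coefficient of `z ^ k` in the Cauchy product is the Chu–Vandermonde sum with offset `0`.
  have hV := sum_choose_mul_pochhammer_div (b := b) (c := b + a) (by positivity) k 0
  simp only [zero_add, ascPochhammer_zero, Polynomial.eval_one, one_mul, add_sub_cancel_left] at hV
  have hV' : pochhammerRatio a b k = ∑ j ∈ Finset.range (k + 1),
      (k.choose j : ℝ) * (-1) ^ j * pochhammerRatio b a j := by
    rw [pochhammerRatio, add_comm a b, ← hV]; rfl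
  rw [hV', Complex.ofReal_sum, Finset.sum_mul]
  refine Finset.sum_congr rfl fun j hj => ?_
  have hjk : j ≤ k := Nat.lt_succ_iff.mp (Finset.mem_range.mp hj)
  have hz : z ^ k = z ^ j * z ^ (k - j) := by rw [← pow_add, Nat.add_sub_cancel' hjk]
  have hch : (k.choose j : ℂ) / (k ! : ℂ) = 1 / ((j ! : ℂ) * ((k - j)! : ℂ)) := by
    rw [Nat.cast_choose ℂ hjk]
    have : (k ! : ℂ) ≠ 0 := by exact_mod_cast k.factorial_ne_zero
    field_simp
  have e1 : (((k.choose j : ℝ) * (-1) ^ j * pochhammerRatio b a j : ℝ) : ℂ) * (z ^ k / (k ! : ℂ))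
      = (-1) ^ j * (pochhammerRatio b a j : ℂ) * z ^ k * ((k.choose j : ℂ) / (k ! : ℂ)) := by
    push_cast; ring
  rw [e1, hch, hz, neg_pow z]
  field_simp

/-- For `x ≥ 0` all terms are nonnegative, so the bound on the coefficients compares the series with
`c * exp (3 / 4 * x)` term by term. -/
theorem exists_exp_le_norm_kummerPhi {a b : ℝ} (ha : 0 < a) (hb : 0 < b) :
    ∃ c : ℝ, 0 < c ∧ ∀ x : ℝ, 0 ≤ x → c * Real.exp (3 / 4 * x) ≤ ‖kummerPhi a b x‖ := by
  obtain ⟨c, hc, hle⟩ := exists_pow_le_pochhammerRatio ha hb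
  refine ⟨c, hc, fun x hx => ?_⟩
  have hs : Summable fun k : ℕ => pochhammerRatio a b k * (x ^ k / k !) := by
    refine Summable.of_norm ?_
    have := summable_norm_kummer ha hb (x : ℂ)
    refine this.congr fun k => ?_
    simp
  have hreal : kummerPhi a b x = ((∑' k : ℕ, pochhammerRatio a b k * (x ^ k / k !) : ℝ) : ℂ) := by
    rw [kummerPhi_eq_tsum, Complex.ofReal_tsum]
    exact tsum_congr fun k => by push_cast; rfl
  rw [hreal, Complex.norm_real]
  refine le_trans ?_ (le_abs_self _)
  rw [Real.exp_eq_exp_ℝ, NormedSpace.exp_eq_tsum_div, ← tsum_mul_left]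
  refine Summable.tsum_le_tsum (fun k => ?_)
    ((Real.summable_pow_div_factorial (3 / 4 * x)).mul_left c) hs
  have : c * ((3 / 4 * x) ^ k / k !) = c * (3 / 4) ^ k * (x ^ k / k !) := by
    rw [mul_pow]; ring
  rw [this]
  gcongr
  exact hle k

theorem infinite_kummerZeros {a b : ℝ} (ha : 0 < a) (hb : 0 < b) : (kummerZeros a b).Infinite := by
  obtain ⟨c, hc, hle⟩ := exists_exp_le_norm_kummerPhi ha hb
  obtain ⟨d, hd, hle'⟩ := exists_exp_le_norm_kummerPhi hb ha
  refine infinite_zeros_of_growth (differentiable_kummerPhi ha hb) (norm_kummerPhi_le ha hb)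
    (lt_min hc hd) (fun x hx => le_trans (by gcongr; exact min_le_left c d) (hle x hx))
    (fun x hx => ?_)
  -- On the negative axis `Φ_{a,b}(-x) = exp (-x) * Φ_{b,a}(x)`, whence the rate `-1 + 3/4 = -1/4`.
  rw [kummerPhi_eq_exp_mul ha hb, neg_neg, norm_mul, Complex.norm_exp]
  have h1 : Real.exp (-(1 / 4) * x) = Real.exp (-x) * Real.exp (3 / 4 * x) := by
    rw [← Real.exp_add]; ring_nf
  have h2 : (-(x : ℂ)).re = -x := by simp
  rw [h1, h2, mul_left_comm]
  gcongr
  exact le_trans (by gcongr; exact min_le_right c d) (hle' x hx)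

theorem summable_kummerZeros_norm_sq {a b : ℝ} (ha : 0 < a) (hb : 0 < b) :
    Summable (fun w : kummerZeros a b => (‖(w : ℂ)‖ ^ 2)⁻¹) :=
  summable_inv_norm_sq_of_card_le (fun _ hw => half_le_norm_of_kummerPhi_eq_zero ha hb hw)
    (fun _ hr s hs => card_zeros_le (differentiable_kummerPhi ha hb) (kummerPhi_zero a b)
      (norm_kummerPhi_le ha hb) hr s hs)

theorem nonempty_equiv_kummerZeros {a b : ℝ} (ha : 0 < a) (hb : 0 < b) :
    Nonempty (ℕ ≃ kummerZeros a b) := by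
  have hinf : Infinite (kummerZeros a b) := (infinite_kummerZeros ha hb).to_subtype
  have hcount : Countable (kummerZeros a b) := by
    -- A summable family has countable support, and here no term vanishes.
    have h := (summable_kummerZeros_norm_sq ha hb).countable_support
    have huniv : Function.support (fun w : kummerZeros a b => (‖(w : ℂ)‖ ^ 2)⁻¹) = Set.univ := by
      ext w
      have := half_le_norm_of_kummerPhi_eq_zero ha hb w.2
      have : ‖(w : ℂ)‖ ≠ 0 := by linarith
      simpa using this
    rw [huniv] at h
    exact Set.countable_univ_iff.mp h
  exact nonempty_equiv_of_countable

/-! ### Moment series of exponential variables and the recurrence for partial sums -/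

theorem integrable_pow_expMeasure (n : ℕ) : Integrable (fun x : ℝ => x ^ n) (expMeasure 1) ∧
    ∫ x, x ^ n ∂(expMeasure 1) = n ! := by
  have hm : Measurable (gammaPDF 1 1) := (measurable_gammaPDFReal 1 1).ennreal_ofReal
  have hfin : ∀ᵐ x : ℝ, gammaPDF 1 1 x < ⊤ := ae_of_all _ fun x => ENNReal.ofReal_lt_top
  have hdens : (fun x => (gammaPDF 1 1 x).toReal • x ^ n) =
      Set.indicator (Set.Ici 0) (fun x : ℝ => Real.exp (-x) * x ^ ((n + 1 : ℝ) - 1)) := by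
    funext x
    rw [gammaPDF, ENNReal.toReal_ofReal (gammaPDFReal_nonneg one_pos one_pos x)]
    by_cases hx : 0 ≤ x
    · simp [gammaPDFReal, hx, Set.indicator]
    · simp [gammaPDFReal, hx, Set.indicator]
  have hpos : (0 : ℝ) < n + 1 := by positivity
  constructor
  · rw [expMeasure, gammaMeasure, integrable_withDensity_iff_integrable_smul' hm hfin, hdens,
      integrable_indicator_iff measurableSet_Ici, integrableOn_Ici_iff_integrableOn_Ioi]
    exact Real.GammaIntegral_convergent hpos
  · rw [expMeasure, gammaMeasure, integral_withDensity_eq_integral_toReal_smul hm hfin, hdens,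
      integral_indicator measurableSet_Ici, integral_Ici_eq_integral_Ioi,
      ← Real.Gamma_eq_integral hpos, Real.Gamma_nat_eq_factorial]

section Moments

variable {Ω : Type*} [MeasurableSpace Ω] {P : Measure Ω}

theorem integral_ofReal_pow_of_hasLaw_expMeasure {G : Ω → ℝ} (hG : HasLaw G (expMeasure 1) P)
    (n : ℕ) : ∫ ω, (G ω : ℂ) ^ n ∂P = n ! := by
  have h := hG.integral_comp (f := fun x : ℝ => x ^ n) (by fun_prop)
  rw [(integrable_pow_expMeasure n).2] at h
  have h2 : (fun ω => (G ω : ℂ) ^ n) = fun ω => ((((fun x : ℝ => x ^ n) ∘ G) ω : ℝ) : ℂ) := by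
    funext ω; simp
  rw [h2, integral_complex_ofReal, h]
  simp

noncomputable section

/-- The exponential generating series of the moments of a complex random variable. -/
def momentSeries (P : Measure Ω) (X : Ω → ℂ) : PowerSeries ℂ :=
  PowerSeries.mk fun n => (∫ ω, X ω ^ n ∂P) / (n ! : ℂ)

end

theorem coeff_momentSeries (X : Ω → ℂ) (n : ℕ) :
    PowerSeries.coeff n (momentSeries P X) = (∫ ω, X ω ^ n ∂P) / (n ! : ℂ) :=
  PowerSeries.coeff_mk _ _

theorem memLp_of_hasLaw_expMeasure {G : Ω → ℝ} (hG : HasLaw G (expMeasure 1) P) (n : ℕ) :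
    MemLp (fun ω => (G ω : ℂ)) n P := by
  rcases eq_or_ne n 0 with rfl | hn
  · simpa [memLp_zero_iff_aestronglyMeasurable, Function.comp_def] using
      (Complex.measurable_ofReal.comp_aemeasurable hG.aemeasurable).aestronglyMeasurable
  have hmeas : AEStronglyMeasurable (fun ω => (G ω : ℂ)) P :=
    (Complex.measurable_ofReal.comp_aemeasurable hG.aemeasurable).aestronglyMeasurable
  rw [← integrable_norm_rpow_iff hmeas (by exact_mod_cast hn) (by simp)]
  have h1 : Integrable (fun x : ℝ => ‖x ^ n‖) (expMeasure 1) := (integrable_pow_expMeasure n).1.norm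
  rw [← hG.map_eq] at h1
  have h2 := h1.comp_aemeasurable hG.aemeasurable
  simpa [Function.comp_def] using h2

variable [IsProbabilityMeasure P]

theorem MeasureTheory.MemLp.integrable_fun_pow {X : Ω → ℂ} {n : ℕ} (hX : MemLp X n P) :
    Integrable (fun ω => X ω ^ n) P := by
  refine (integrable_norm_iff (hX.1.pow n)).mp ?_
  simpa using hX.integrable_norm_pow'

theorem memLp_exponential_sub_one_mul {G : Ω → ℝ} (hG : HasLaw G (expMeasure 1) P) (c : ℂ) (n : ℕ) :
    MemLp (fun ω => ((G ω : ℂ) - 1) * c) n P :=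
  ((memLp_of_hasLaw_expMeasure hG n).sub (memLp_const 1)).mul_const c

/-- The binomial theorem, with expectations of products factoring by independence. -/
theorem momentSeries_add {X Y : Ω → ℂ} (hX : ∀ n : ℕ, MemLp X n P) (hY : ∀ n : ℕ, MemLp Y n P)
    (hXY : IndepFun X Y P) :
    momentSeries P (fun ω => X ω + Y ω) = momentSeries P X * momentSeries P Y := by
  have hind : ∀ i j : ℕ, IndepFun (fun ω => X ω ^ i) (fun ω => Y ω ^ j) P := fun i j =>
    hXY.comp (by fun_prop : Measurable fun x : ℂ => x ^ i) (by fun_prop : Measurable fun x : ℂ => x ^ j)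
  have hint : ∀ i j : ℕ, Integrable (fun ω => X ω ^ i * Y ω ^ j) P := fun i j =>
    (hind i j).integrable_mul (hX i).integrable_fun_pow (hY j).integrable_fun_pow
  ext n
  rw [PowerSeries.coeff_mul]
  simp only [coeff_momentSeries]
  have h1 : ∫ ω, (X ω + Y ω) ^ n ∂P = ∑ m ∈ Finset.HasAntidiagonal.antidiagonal n,
      (n.choose m.1 : ℂ) * ((∫ ω, X ω ^ m.1 ∂P) * ∫ ω, Y ω ^ m.2 ∂P) := by
    have hpow : ∀ ω, (X ω + Y ω) ^ n = ∑ m ∈ Finset.HasAntidiagonal.antidiagonal n,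
        (n.choose m.1 : ℂ) * (X ω ^ m.1 * Y ω ^ m.2) := fun ω => by
      simp only [(Commute.all (X ω) (Y ω)).add_pow', nsmul_eq_mul]
    simp only [hpow]
    rw [integral_finsetSum _ fun m _ => (hint m.1 m.2).const_mul _]
    refine Finset.sum_congr rfl fun m _ => ?_
    rw [integral_const_mul, (hind m.1 m.2).integral_fun_mul_eq_mul_integral
      (hX m.1).integrable_fun_pow.1 (hY m.2).integrable_fun_pow.1]
  rw [h1, Finset.sum_div]
  refine Finset.sum_congr rfl fun m hm => ?_
  have hm' := Finset.HasAntidiagonal.mem_antidiagonal.mp hm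
  rw [← hm', Nat.cast_add_choose ℂ]
  have h2 : ((m.1 + m.2)! : ℂ) ≠ 0 := by exact_mod_cast (m.1 + m.2).factorial_ne_zero
  field_simp

theorem derivative_momentSeries_const (s : ℂ) :
    PowerSeries.derivative ℂ (momentSeries P (fun _ => s)) =
      momentSeries P (fun _ => s) * PowerSeries.mk fun j => if j = 0 then s else 0 := by
  have hC : (PowerSeries.mk fun j => if j = 0 then s else 0) = PowerSeries.C s := by
    ext j; simp [PowerSeries.coeff_C]
  ext n
  rw [hC, PowerSeries.coeff_mul_C, PowerSeries.coeff_derivative, coeff_momentSeries,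
    coeff_momentSeries, Nat.factorial_succ]
  simp only [integral_const, probReal_univ, one_smul]
  have : (n ! : ℂ) ≠ 0 := by exact_mod_cast n.factorial_ne_zero
  have : (n : ℂ) + 1 ≠ 0 := by exact_mod_cast n.succ_ne_zero
  push_cast
  field_simp
  ring

theorem momentSeries_const_ne_zero (s : ℂ) : momentSeries P (fun _ => s) ≠ 0 := by
  intro h
  have := congrArg (PowerSeries.coeff 0) h
  simp [coeff_momentSeries] at this

/-- The series is `A = exp (-c t) / (1 - c t)`, with logarithmic derivative `c / (1 - c t) - c`.
Formally, `E = A * e` with `E` geometric and `e = exp (c t)`; then `E' = c * E ^ 2` and `e' = c *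
e`, and `e` cancels. -/
theorem derivative_momentSeries_exponential {G : Ω → ℝ} (hG : HasLaw G (expMeasure 1) P) (c : ℂ) :
    PowerSeries.derivative ℂ (momentSeries P (fun ω => ((G ω : ℂ) - 1) * c)) =
      momentSeries P (fun ω => ((G ω : ℂ) - 1) * c) *
        PowerSeries.mk fun j => if j = 0 then 0 else c ^ (j + 1) := by
  have hfull : momentSeries P (fun ω => (G ω : ℂ) * c) = PowerSeries.mk fun n => c ^ n := by
    ext n
    rw [coeff_momentSeries, PowerSeries.coeff_mk]
    simp only [mul_pow]
    rw [integral_mul_const, integral_ofReal_pow_of_hasLaw_expMeasure hG]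
    have : (n ! : ℂ) ≠ 0 := by exact_mod_cast n.factorial_ne_zero
    field_simp
  set A := momentSeries P (fun ω => ((G ω : ℂ) - 1) * c) with hA
  set e := momentSeries P (fun _ : Ω => c) with he
  set E : PowerSeries ℂ := PowerSeries.mk fun n => c ^ n with hE
  have hprod : E = A * e := by
    rw [← hfull, hA, he, ← momentSeries_add]
    · congr 1
      funext ω; ring
    · exact memLp_exponential_sub_one_mul hG c
    · exact fun n => memLp_const c
    · exact indepFun_const_right _ _
  have hE' : PowerSeries.derivative ℂ E = PowerSeries.C c * (E * E) := by
    ext n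
    rw [PowerSeries.coeff_derivative, PowerSeries.coeff_C_mul, PowerSeries.coeff_mul]
    simp only [hE, PowerSeries.coeff_mk, ← pow_add]
    rw [Finset.sum_congr rfl (g := fun _ => c ^ n)
      (fun m hm => by rw [Finset.HasAntidiagonal.mem_antidiagonal.mp hm])]
    simp
    ring
  have he' : PowerSeries.derivative ℂ e = e * PowerSeries.C c := by
    rw [he, derivative_momentSeries_const]
    congr 1
    ext j; simp [PowerSeries.coeff_C]
  have hL : (PowerSeries.mk fun j => if j = 0 then 0 else c ^ (j + 1)) =
      PowerSeries.C c * (E - 1) := by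
    ext j
    rw [PowerSeries.coeff_C_mul, PowerSeries.coeff_mk, map_sub, hE, PowerSeries.coeff_mk,
      PowerSeries.coeff_one]
    rcases eq_or_ne j 0 with rfl | hj
    · simp
    · simp [hj, pow_succ, mul_comm]
  rw [hL]
  refine mul_right_cancel₀ (momentSeries_const_ne_zero (P := P) c) ?_
  have hd := congrArg (PowerSeries.derivative ℂ) hprod
  rw [Derivation.leibniz, hE', he', smul_eq_mul, smul_eq_mul] at hd
  rw [← he]
  linear_combination (-1 : PowerSeries ℂ) * hd + PowerSeries.C c * E * hprod

variable {G : ℕ → Ω → ℝ}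

theorem memLp_partialSum (hG : ∀ k, HasLaw (G k) (expMeasure 1) P) (s : ℂ) (c : ℕ → ℂ) (N n : ℕ) :
    MemLp (fun ω => s + ∑ k ∈ Finset.range N, ((G k ω : ℂ) - 1) * c k) n P :=
  (memLp_const s).add (memLp_finsetSum _ fun k _ => memLp_exponential_sub_one_mul (hG k) (c k) n)

/-- Logarithmic derivatives add over independent summands; the centring of `G k` confines `s` to
degree `0`. -/
theorem derivative_momentSeries_partialSum (hG : ∀ k, HasLaw (G k) (expMeasure 1) P)
    (hI : iIndepFun G P) (s : ℂ) (c : ℕ → ℂ) (N : ℕ) :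
    PowerSeries.derivative ℂ (momentSeries P
      (fun ω => s + ∑ k ∈ Finset.range N, ((G k ω : ℂ) - 1) * c k)) =
      momentSeries P (fun ω => s + ∑ k ∈ Finset.range N, ((G k ω : ℂ) - 1) * c k) *
        PowerSeries.mk fun j => if j = 0 then s else ∑ k ∈ Finset.range N, c k ^ (j + 1) := by
  induction N with
  | zero => simpa using derivative_momentSeries_const s
  | succ N ih =>
    have hI' : iIndepFun (fun k ω => ((G k ω : ℂ) - 1) * c k) P :=
      hI.comp (fun k (x : ℝ) => ((x : ℂ) - 1) * c k) (fun k => by fun_prop)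
    have hm : ∀ k, AEMeasurable (fun ω => ((G k ω : ℂ) - 1) * c k) P := fun k =>
      ((Complex.measurable_ofReal.comp_aemeasurable (hG k).aemeasurable).sub_const 1).mul_const _
    have hind := hI'.indepFun_finsetSum_of_notMem₀ hm (s := Finset.range N) (i := N) (by simp)
    have hind' : IndepFun (fun ω => s + ∑ k ∈ Finset.range N, ((G k ω : ℂ) - 1) * c k)
        (fun ω => ((G N ω : ℂ) - 1) * c N) P := by
      have := hind.comp (by fun_prop : Measurable fun x => s + x) measurable_id
      refine this.congr (ae_of_all _ fun ω => ?_) (ae_of_all _ fun ω => rfl)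
      simp
    have hsum : (fun ω => s + ∑ k ∈ Finset.range (N + 1), ((G k ω : ℂ) - 1) * c k) =
        fun ω => (s + ∑ k ∈ Finset.range N, ((G k ω : ℂ) - 1) * c k) + ((G N ω : ℂ) - 1) * c N := by
      funext ω
      rw [Finset.sum_range_succ, add_assoc]
    rw [hsum, momentSeries_add (memLp_partialSum hG s c N)
      (memLp_exponential_sub_one_mul (hG N) (c N)) hind',
      Derivation.leibniz, ih, derivative_momentSeries_exponential (hG N), smul_eq_mul, smul_eq_mul]
    have hL : (PowerSeries.mk fun j => if j = 0 then s else
          ∑ k ∈ Finset.range (N + 1), c k ^ (j + 1)) =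
        (PowerSeries.mk fun j => if j = 0 then s else ∑ k ∈ Finset.range N, c k ^ (j + 1)) +
          PowerSeries.mk fun j => if j = 0 then 0 else c N ^ (j + 1) := by
      ext j
      rcases eq_or_ne j 0 with rfl | hj
      · simp
      · simp [hj, Finset.sum_range_succ]
    rw [hL]
    ring

/-- The moment recurrence for the partial sums. -/
theorem moment_partialSum_succ (hG : ∀ k, HasLaw (G k) (expMeasure 1) P)
    (hI : iIndepFun G P) (s : ℂ) (c : ℕ → ℂ) (N n : ℕ) :
    (∫ ω, (s + ∑ k ∈ Finset.range N, ((G k ω : ℂ) - 1) * c k) ^ (n + 1) ∂P) =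
      s * (∫ ω, (s + ∑ k ∈ Finset.range N, ((G k ω : ℂ) - 1) * c k) ^ n ∂P) +
      n ! * ∑ j ∈ Finset.range n,
        (∫ ω, (s + ∑ k ∈ Finset.range N, ((G k ω : ℂ) - 1) * c k) ^ (n - (j + 1)) ∂P) /
          ((n - (j + 1))! : ℂ) * ∑ k ∈ Finset.range N, c k ^ (j + 2) := by
  -- The recurrence is the coefficient of degree `n`; `Finset.sum_range_succ'` splits off the term
  -- with `s`.
  have h := congrArg (PowerSeries.coeff n) (derivative_momentSeries_partialSum hG hI s c N)
  rw [PowerSeries.coeff_derivative, mul_comm (momentSeries P _), PowerSeries.coeff_mul,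
    Finset.Nat.sum_antidiagonal_eq_sum_range_succ_mk, Finset.sum_range_succ'] at h
  simp only [coeff_momentSeries, PowerSeries.coeff_mk, Nat.factorial_succ, Nat.sub_zero,
    if_true, Nat.succ_ne_zero, if_false] at h
  have h1 : (n ! : ℂ) ≠ 0 := by exact_mod_cast n.factorial_ne_zero
  have h2 : (n : ℂ) + 1 ≠ 0 := by exact_mod_cast n.succ_ne_zero
  push_cast at h
  have h3 : ∀ x : ℂ, x / (((n : ℂ) + 1) * n !) * (n + 1) = x / n ! := fun x => by field_simp
  rw [h3, div_eq_iff h1] at h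
  rw [h, add_mul, mul_assoc s, div_mul_cancel₀ _ h1, add_comm, mul_comm (Finset.sum _ _)]
  congr 2
  exact Finset.sum_congr rfl fun j _ => mul_comm _ _

end Moments

/-! ### Passage to the limit -/

open Filter Topology in
/-- A sequence bounded in `L²` that converges almost everywhere has convergent integrals. -/
theorem tendsto_integral_of_sq_bounded {Ω : Type*} [MeasurableSpace Ω] {P : Measure Ω}
    [IsProbabilityMeasure P] {f : ℕ → Ω → ℂ} {g : Ω → ℂ} (hf : ∀ n, MemLp (f n) 2 P) {K : ℝ}
    (hK : ∀ n, ∫ ω, ‖f n ω‖ ^ 2 ∂P ≤ K)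
    (hlim : ∀ᵐ ω ∂P, Tendsto (fun n => f n ω) atTop (𝓝 (g ω))) :
    Integrable g P ∧ Tendsto (fun n => ∫ ω, f n ω ∂P) atTop (𝓝 (∫ ω, g ω ∂P)) := by
  have hK0 : 0 ≤ K := (integral_nonneg fun ω => by positivity).trans (hK 0)
  have hgm : AEStronglyMeasurable g P := aestronglyMeasurable_of_tendsto_ae _ (fun n => (hf n).1) hlim
  have hnorm : ∀ h : Ω → ℂ, MemLp h 2 P →
      eLpNorm h 2 P = ENNReal.ofReal (√(∫ ω, ‖h ω‖ ^ 2 ∂P)) := by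
    intro h hh
    rw [hh.eLpNorm_eq_integral_rpow_norm (by simp) (by simp), Real.sqrt_eq_rpow]
    simp
  -- Fatou's lemma: the limit inherits the `L²` bound.
  have hgle : eLpNorm g 2 P ≤ ENNReal.ofReal (√K) := by
    refine (Lp.eLpNorm_lim_le_liminf_eLpNorm (fun n => (hf n).1) g hlim).trans ?_
    refine liminf_le_of_le (by isBoundedDefault) fun b hb => ?_
    obtain ⟨n, hn⟩ := hb.exists
    refine hn.trans ?_
    rw [hnorm _ (hf n)]
    exact ENNReal.ofReal_le_ofReal (Real.sqrt_le_sqrt (hK n))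
  have hg : MemLp g 2 P := ⟨hgm, hgle.trans_lt ENNReal.ofReal_lt_top⟩
  have hgK : ∫ ω, ‖g ω‖ ^ 2 ∂P ≤ K := by
    rw [hnorm _ hg, ENNReal.ofReal_le_ofReal_iff (Real.sqrt_nonneg _),
      Real.sqrt_le_sqrt_iff hK0] at hgle
    exact hgle
  refine ⟨hg.integrable (by norm_num), ?_⟩
  -- A continuous truncation, bounded by `m` and within `‖x‖ ^ 2 / m` of `x`: dominated convergence
  -- applies to it, at a uniform cost of `K / m`.
  set T : ℝ → ℂ → ℂ := fun m x => ((m / (m + ‖x‖) : ℝ) : ℂ) * x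
  have hTc : ∀ m, 0 < m → Continuous (T m) := fun m hm => by
    refine (Complex.continuous_ofReal.comp (Continuous.div (by fun_prop) (by fun_prop)
      fun x => ?_)).mul continuous_id
    positivity
  have hTb : ∀ m, 0 < m → ∀ x, ‖T m x‖ ≤ m := fun m hm x => by
    simp only [T]
    rw [norm_mul, Complex.norm_real, Real.norm_of_nonneg (by positivity), div_mul_eq_mul_div,
      div_le_iff₀ (by positivity)]
    nlinarith [norm_nonneg x]
  have hTd : ∀ m, 0 < m → ∀ x, ‖x - T m x‖ ≤ ‖x‖ ^ 2 / m := fun m hm x => by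
    have hpos : 0 < m + ‖x‖ := by positivity
    have h1 : x - T m x = ((‖x‖ / (m + ‖x‖) : ℝ) : ℂ) * x := by
      have : (‖x‖ / (m + ‖x‖) : ℝ) = 1 - m / (m + ‖x‖) := by field_simp; ring
      rw [this]; simp only [T]; push_cast; ring
    rw [h1, norm_mul, Complex.norm_real, Real.norm_of_nonneg (by positivity), div_mul_eq_mul_div,
      div_le_div_iff₀ hpos hm]
    nlinarith [norm_nonneg x, pow_nonneg (norm_nonneg x) 3]
  have hTi : ∀ m, 0 < m → ∀ h : Ω → ℂ, AEStronglyMeasurable h P →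
      Integrable (fun ω => T m (h ω)) P := fun m hm h hh =>
    Integrable.of_bound ((hTc m hm).comp_aestronglyMeasurable hh) m (ae_of_all _ fun ω => hTb m hm _)
  have hclose : ∀ m, 0 < m → ∀ h : Ω → ℂ, MemLp h 2 P → ∫ ω, ‖h ω‖ ^ 2 ∂P ≤ K →
      ‖∫ ω, h ω ∂P - ∫ ω, T m (h ω) ∂P‖ ≤ K / m := fun m hm h hh hhK => by
    have hi : Integrable (fun ω => ‖h ω‖ ^ 2 / m) P :=
      (hh.integrable_norm_pow (p := 2) two_ne_zero).div_const m
    rw [← integral_sub (hh.integrable (by norm_num)) (hTi m hm h hh.1)]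
    refine (norm_integral_le_of_norm_le hi (ae_of_all _ fun ω => hTd m hm _)).trans ?_
    rw [integral_div]
    gcongr
  rw [Metric.tendsto_atTop]
  intro ε hε
  obtain ⟨m, hm⟩ := exists_nat_gt (3 * K / ε)
  have hm0 : (0 : ℝ) < m := lt_of_le_of_lt (by positivity) hm
  have hKm : K / m < ε / 3 := by
    rw [div_lt_iff₀ hε] at hm
    rw [div_lt_iff₀ hm0]
    linarith
  have hT : Tendsto (fun n => ∫ ω, T m (f n ω) ∂P) atTop (𝓝 (∫ ω, T m (g ω) ∂P)) := by
    refine tendsto_integral_of_dominated_convergence (fun _ => (m : ℝ))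
      (fun n => (hTi m hm0 _ (hf n).1).1) (integrable_const _)
      (fun n => ae_of_all _ fun ω => hTb m hm0 _) ?_
    filter_upwards [hlim] with ω hω
    exact ((hTc m hm0).tendsto _).comp hω
  obtain ⟨N, hN⟩ := Metric.tendsto_atTop.mp hT (ε / 3) (by positivity)
  refine ⟨N, fun n hn => ?_⟩
  have h1 := hclose m hm0 _ (hf n) (hK n)
  have h2 := hN n hn
  have h3 := hclose m hm0 _ hg hgK
  rw [← dist_eq_norm] at h1 h3
  rw [dist_comm] at h3
  have h4 := dist_triangle4 (∫ ω, f n ω ∂P) (∫ ω, T m (f n ω) ∂P) (∫ ω, T m (g ω) ∂P)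
    (∫ ω, g ω ∂P)
  linarith

open Filter Topology in
/-- A series of independent centred real variables with partial sums bounded in `L¹` converges
almost surely. -/
theorem ae_exists_tendsto_sum_of_iIndepFun {Ω : Type*} [MeasurableSpace Ω] {P : Measure Ω}
    [IsProbabilityMeasure P] {u : ℕ → Ω → ℝ} (hu : ∀ k, Integrable (u k) P)
    (hI : iIndepFun u P) (hmean : ∀ k, ∫ ω, u k ω ∂P = 0) {R : ℝ}
    (hR : ∀ N, ∫ ω, ‖∑ k ∈ Finset.range N, u k ω‖ ∂P ≤ R) :
    ∀ᵐ ω ∂P, ∃ l, Tendsto (fun N => ∑ k ∈ Finset.range N, u k ω) atTop (𝓝 l) := by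
  have hR0 : 0 ≤ R := (integral_nonneg fun ω => norm_nonneg _).trans (hR 0)
  choose v hvm hv using fun k => (hu k).1
  have hvi : ∀ k, Integrable (v k) P := fun k => (hu k).congr (hv k)
  have hIv : iIndepFun v P := hI.congr hv
  have hmeanv : ∀ k, ∫ ω, v k ω ∂P = 0 := fun k => by
    rw [← hmean k]; exact (integral_congr_ae (hv k)).symm
  -- The sum runs up to index `N` inclusive, to match the natural filtration at time `N`; the shift
  -- is undone at the end.
  set S : ℕ → Ω → ℝ := fun N => ∑ k ∈ Finset.range (N + 1), v k
  have hmart : Martingale S (Filtration.natural v hvm) P := by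
    refine martingale_of_condExp_sub_eq_zero_nat (fun N => ?_) (fun N => ?_) (fun N => ?_)
    · refine Finset.stronglyMeasurable_sum _ fun k hk => ?_
      exact (Filtration.stronglyAdapted_natural hvm k).mono
        ((Filtration.natural v hvm).mono (Nat.lt_succ_iff.mp (Finset.mem_range.mp hk)))
    · exact integrable_finsetSum' _ fun k _ => hvi k
    · have h1 : S (N + 1) - S N = v (N + 1) := by
        simp only [S]
        rw [Finset.sum_range_succ _ (N + 1), add_sub_cancel_left]
      rw [h1]
      refine (hIv.condExp_natural_ae_eq_of_lt hvm (Nat.lt_succ_self N)).trans ?_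
      rw [hmeanv]; rfl
  have hall : ∀ᵐ ω ∂P, ∀ k, u k ω = v k ω := ae_all_iff.mpr hv
  have hconv := hmart.submartingale.exists_ae_tendsto_of_bdd (R := R.toNNReal) (fun N => by
    rw [eLpNorm_one_eq_lintegral_enorm,
      ← ofReal_integral_norm_eq_lintegral_enorm (hmart.integrable N)]
    refine ENNReal.ofReal_le_ofReal ?_
    refine le_trans (le_of_eq (integral_congr_ae ?_)) (hR (N + 1))
    filter_upwards [hall] with ω hω
    simp [S, hω])
  filter_upwards [hconv, hall] with ω ⟨l, hl⟩ hω
  refine ⟨l, (tendsto_add_atTop_iff_nat 1).mp (hl.congr fun N => ?_)⟩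
  simp [S, hω]

theorem summable_norm_pow_of_sq {c : ℕ → ℂ} (hc : Summable fun k => ‖c k‖ ^ 2) {j : ℕ}
    (hj : 2 ≤ j) : Summable fun k => ‖c k‖ ^ j := by
  refine Summable.of_nonneg_of_le (fun k => by positivity) (fun k => ?_)
    (hc.mul_left (√(∑' i, ‖c i‖ ^ 2) ^ (j - 2)))
  have h1 : ‖c k‖ ≤ √(∑' i, ‖c i‖ ^ 2) :=
    Real.le_sqrt_of_sq_le (hc.le_tsum k fun i _ => by positivity)
  calc ‖c k‖ ^ j = ‖c k‖ ^ (j - 2) * ‖c k‖ ^ 2 := by rw [← pow_add, Nat.sub_add_cancel hj]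
    _ ≤ _ := by gcongr

section Moments

variable {Ω : Type*} [MeasurableSpace Ω] {P : Measure Ω} [IsProbabilityMeasure P]
  {G : ℕ → Ω → ℝ}

/-- Strong induction through the recurrence, whose power sums are bounded uniformly in `N`. -/
theorem exists_norm_moment_partialSum_le (hG : ∀ k, HasLaw (G k) (expMeasure 1) P)
    (hI : iIndepFun G P) (s : ℂ) {c : ℕ → ℂ} (hc : Summable fun k => ‖c k‖ ^ 2) (n : ℕ) :
    ∃ K : ℝ, ∀ N,
      ‖∫ ω, (s + ∑ k ∈ Finset.range N, ((G k ω : ℂ) - 1) * c k) ^ n ∂P‖ ≤ K := by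
  induction n using Nat.strong_induction_on with
  | _ n ih =>
    rcases n with _ | n
    · exact ⟨1, fun N => by simp⟩
    choose! K hK using ih
    refine ⟨‖s‖ * K n + n ! * ∑ j ∈ Finset.range n,
      K (n - (j + 1)) / (n - (j + 1))! * ∑' k, ‖c k‖ ^ (j + 2), fun N => ?_⟩
    rw [moment_partialSum_succ hG hI]
    refine (norm_add_le _ _).trans (add_le_add ?_ ?_)
    · rw [norm_mul]
      exact mul_le_mul_of_nonneg_left (hK n (by omega) N) (norm_nonneg s)
    · rw [norm_mul, Complex.norm_natCast]
      refine mul_le_mul_of_nonneg_left ((norm_sum_le _ _).trans (Finset.sum_le_sum fun j hj => ?_))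
        (by positivity)
      rw [norm_mul, norm_div, Complex.norm_natCast]
      have h1 := hK (n - (j + 1)) (by omega) N
      have h2 : ‖∑ k ∈ Finset.range N, c k ^ (j + 2)‖ ≤ ∑' k, ‖c k‖ ^ (j + 2) := by
        refine (norm_sum_le _ _).trans ?_
        simp only [norm_pow]
        exact (summable_norm_pow_of_sq hc (by omega)).sum_le_tsum _ fun k _ => by positivity
      have h3 := (norm_nonneg _).trans h1
      gcongr

/-- The even absolute moments of the partial sums are bounded. -/
theorem exists_integral_norm_partialSum_le (hG : ∀ k, HasLaw (G k) (expMeasure 1) P)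
    (hI : iIndepFun G P) (s : ℂ) {c : ℕ → ℂ} (hc : Summable fun k => ‖c k‖ ^ 2) {n : ℕ}
    (hn : Even n) :
    ∃ K : ℝ, ∀ N,
      ∫ ω, ‖s + ∑ k ∈ Finset.range N, ((G k ω : ℂ) - 1) * c k‖ ^ n ∂P ≤ K := by
  -- Moments of a complex variable do not control its absolute moments. For real coefficients and
  -- even `n` the two agree, so real and imaginary parts are treated separately.
  have hreal : ∀ (t : ℝ) (d : ℕ → ℝ), (∀ k, |d k| ≤ ‖c k‖) → ∃ K : ℝ, ∀ N,
      Integrable (fun ω => |t + ∑ k ∈ Finset.range N, (G k ω - 1) * d k| ^ n) P ∧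
      ∫ ω, |t + ∑ k ∈ Finset.range N, (G k ω - 1) * d k| ^ n ∂P ≤ K := by
    intro t d hd
    have hds : Summable fun k => ‖(d k : ℂ)‖ ^ 2 :=
      Summable.of_nonneg_of_le (fun k => by positivity) (fun k => by
        rw [Complex.norm_real, Real.norm_eq_abs]
        gcongr
        exact hd k) hc
    obtain ⟨K, hK⟩ := exists_norm_moment_partialSum_le hG hI (t : ℂ) hds n
    have hcast : ∀ N ω, ((t : ℂ) + ∑ k ∈ Finset.range N, ((G k ω : ℂ) - 1) * (d k : ℂ)) =
        ((t + ∑ k ∈ Finset.range N, (G k ω - 1) * d k : ℝ) : ℂ) := fun N ω => by push_cast; rfl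
    refine ⟨K, fun N => ⟨?_, ?_⟩⟩
    · have := (memLp_partialSum hG (t : ℂ) (fun k => (d k : ℂ)) N n).integrable_norm_pow'
      simpa only [hcast, Complex.norm_real, Real.norm_eq_abs] using this
    · have h1 := hK N
      simp only [hcast, ← Complex.ofReal_pow] at h1
      rw [integral_complex_ofReal, Complex.norm_real] at h1
      refine le_trans (le_of_eq ?_) ((le_abs_self _).trans h1)
      simp only [hn.pow_abs]
  obtain ⟨K₁, hK₁⟩ := hreal s.re (fun k => (c k).re) fun k => Complex.abs_re_le_norm _
  obtain ⟨K₂, hK₂⟩ := hreal s.im (fun k => (c k).im) fun k => Complex.abs_im_le_norm _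
  refine ⟨2 ^ (n - 1) * (K₁ + K₂), fun N => ?_⟩
  have hle : ∀ ω, ‖s + ∑ k ∈ Finset.range N, ((G k ω : ℂ) - 1) * c k‖ ^ n ≤
      2 ^ (n - 1) * (|s.re + ∑ k ∈ Finset.range N, (G k ω - 1) * (c k).re| ^ n +
        |s.im + ∑ k ∈ Finset.range N, (G k ω - 1) * (c k).im| ^ n) := by
    intro ω
    refine le_trans ?_ (add_pow_le (abs_nonneg _) (abs_nonneg _) n)
    gcongr
    refine (Complex.norm_le_abs_re_add_abs_im _).trans (le_of_eq ?_)
    simp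
  refine (integral_mono (memLp_partialSum hG s c N n).integrable_norm_pow'
    (((hK₁ N).1.add (hK₂ N).1).const_mul _) hle).trans ?_
  rw [integral_const_mul]
  refine mul_le_mul_of_nonneg_left ?_ (by positivity)
  exact (integral_add (hK₁ N).1 (hK₂ N).1).trans_le (add_le_add (hK₁ N).2 (hK₂ N).2)

open Filter Topology in
theorem ae_exists_tendsto_partialSum (hG : ∀ k, HasLaw (G k) (expMeasure 1) P)
    (hI : iIndepFun G P) {c : ℕ → ℂ} (hc : Summable fun k => ‖c k‖ ^ 2) :
    ∀ᵐ ω ∂P, ∃ l, Tendsto (fun N => ∑ k ∈ Finset.range N, ((G k ω : ℂ) - 1) * c k)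
      atTop (𝓝 l) := by
  have hreal : ∀ d : ℕ → ℝ, (∀ k, |d k| ≤ ‖c k‖) → ∀ᵐ ω ∂P, ∃ l,
      Tendsto (fun N => ∑ k ∈ Finset.range N, (G k ω - 1) * d k) atTop (𝓝 l) := by
    intro d hd
    have hGi : ∀ k, Integrable (G k) P := fun k => by
      have := ((memLp_of_hasLaw_expMeasure (hG k) 1).integrable (by simp)).re
      simpa using this
    have hds : Summable fun k => ‖(d k : ℂ)‖ ^ 2 :=
      Summable.of_nonneg_of_le (fun k => by positivity) (fun k => by
        rw [Complex.norm_real, Real.norm_eq_abs]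
        gcongr
        exact hd k) hc
    obtain ⟨K, hK⟩ := exists_integral_norm_partialSum_le hG hI 0 hds even_two
    have hcast : ∀ N ω, ((0 : ℂ) + ∑ k ∈ Finset.range N, ((G k ω : ℂ) - 1) * (d k : ℂ)) =
        ((∑ k ∈ Finset.range N, (G k ω - 1) * d k : ℝ) : ℂ) := fun N ω => by push_cast; simp
    have hui : ∀ k, Integrable (fun ω => (G k ω - 1) * d k) P := fun k =>
      ((hGi k).sub (integrable_const 1)).mul_const _
    refine ae_exists_tendsto_sum_of_iIndepFun (R := 1 + K) hui
      (hI.comp (fun k x => (x - 1) * d k) fun k => by fun_prop) (fun k => ?_) (fun N => ?_)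
    · have h1 : ∫ ω, G k ω ∂P = 1 := by
        have := integral_ofReal_pow_of_hasLaw_expMeasure (hG k) 1
        simp only [pow_one, Nat.factorial_one, Nat.cast_one] at this
        rw [integral_complex_ofReal] at this
        exact_mod_cast this
      rw [integral_mul_const, integral_sub (hGi k) (integrable_const 1), h1]
      simp
    · have h2 := (memLp_partialSum hG 0 (fun k => (d k : ℂ)) N 2).integrable_norm_pow'
      have h3 := hK N
      simp only [hcast, Complex.norm_real] at h2 h3
      -- The `L¹` bound for martingale convergence follows from the second moment by `x ≤ 1 + x ^
      -- 2`.
      calc ∫ ω, ‖∑ k ∈ Finset.range N, (G k ω - 1) * d k‖ ∂P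
          ≤ ∫ ω, (1 + ‖∑ k ∈ Finset.range N, (G k ω - 1) * d k‖ ^ 2) ∂P := by
            refine integral_mono (integrable_finsetSum _ fun k _ => hui k).norm
              ((integrable_const 1).add h2) fun ω => ?_
            dsimp only
            nlinarith [sq_nonneg (‖∑ k ∈ Finset.range N, (G k ω - 1) * d k‖ - 1)]
        _ = 1 + ∫ ω, ‖∑ k ∈ Finset.range N, (G k ω - 1) * d k‖ ^ 2 ∂P := by
            rw [integral_add (integrable_const 1) h2]; simp
        _ ≤ 1 + K := by linarith
  filter_upwards [hreal (fun k => (c k).re) fun k => Complex.abs_re_le_norm _,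
    hreal (fun k => (c k).im) fun k => Complex.abs_im_le_norm _] with ω ⟨x, hx⟩ ⟨y, hy⟩
  refine ⟨x + y * Complex.I, ?_⟩
  have := ((Complex.continuous_ofReal.tendsto x).comp hx).add
    (((Complex.continuous_ofReal.tendsto y).comp hy).mul_const Complex.I)
  refine this.congr fun N => ?_
  apply Complex.ext <;> simp

end Moments

/-! ### Zeta values and the main theorem -/

theorem summable_one_div_kummerZeros_cpow {a b : ℝ} (ha : 0 < a) (hb : 0 < b) {j : ℕ}
    (hj : 2 ≤ j) : Summable (fun w : kummerZeros a b => 1 / (w : ℂ) ^ (j : ℂ)) := by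
  obtain ⟨z⟩ := nonempty_equiv_kummerZeros ha hb
  rw [← z.summable_iff]
  have h := (z.summable_iff.mpr (summable_kummerZeros_norm_sq ha hb))
  refine Summable.of_norm ?_
  have := summable_norm_pow_of_sq (c := fun k => ((z k : ℂ))⁻¹)
    (by simpa [Function.comp_def] using h) hj
  simpa [Function.comp_def] using this

open Filter Topology in
theorem tendsto_sum_hypergeometricZeta {a b : ℝ} (ha : 0 < a) (hb : 0 < b)
    (z : ℕ ≃ kummerZeros a b) {j : ℕ} (hj : 2 ≤ j) :
    Tendsto (fun N => ∑ k ∈ Finset.range N, ((z k : ℂ))⁻¹ ^ j) atTop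
      (𝓝 (hypergeometricZeta a b (j : ℂ))) := by
  have h := (z.hasSum_iff.mpr (summable_one_div_kummerZeros_cpow ha hb hj).hasSum)
  have h2 := h.tendsto_sum_nat
  simpa [Function.comp_def, hypergeometricZeta] using h2

open Filter Topology in
theorem hasSum_conditional_nat_iff {f : ℕ → ℂ} {l : ℂ} :
    HasSum f l (SummationFilter.conditional ℕ) ↔
      Tendsto (fun N => ∑ k ∈ Finset.range N, f k) atTop (𝓝 l) := by
  rw [HasSum, SummationFilter.conditional_filter_eq_map_range, tendsto_map'_iff]
  rfl

open Filter Topology in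
theorem mainTheorem12 (a b : ℝ) (ha : 0 < a) (hb : 0 < b) :
    -- the zeros of `Φ_{a,b}` form an infinite sequence
    Nonempty (ℕ ≃ kummerZeros a b) ∧
    -- the zeta values that occur are given by absolutely convergent series
    (∀ j : ℕ, 2 ≤ j → Summable (fun w : kummerZeros a b => 1 / (w : ℂ) ^ (j : ℂ))) ∧
    -- for every enumeration of the zeros and all i.i.d. exponential variables `G 0, G 1, …`
    ∀ (z : ℕ ≃ kummerZeros a b) {Ω : Type*} [MeasurableSpace Ω] (P : Measure Ω)
      [IsProbabilityMeasure P] (G : ℕ → Ω → ℝ),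
      (∀ k, HasLaw (G k) (expMeasure 1) P) → iIndepFun G P →
      -- the series that defines `𝔷_{a,b}` converges almost surely
      (∀ᵐ ω ∂P, Summable (fun k : ℕ => ((G k ω : ℂ) - 1) / (z k : ℂ))
        (SummationFilter.conditional ℕ)) ∧
      -- its moments are finite
      (∀ n : ℕ, Integrable (fun ω => kummerZ a b z G ω ^ n) P) ∧
      -- the recurrence
      ∀ n : ℕ, 1 ≤ n →
        ((n - 1)! : ℂ) * ∑ j ∈ Finset.Icc 2 n,
            hypergeometricBernoulli P a b z G (n - j) / ((n - j)! : ℂ) *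
              hypergeometricZeta a b (j : ℂ) =
          (a : ℂ) / ((a : ℂ) + (b : ℂ)) * hypergeometricBernoulli P a b z G (n - 1) +
            hypergeometricBernoulli P a b z G n := by
  refine ⟨nonempty_equiv_kummerZeros ha hb,
    fun j hj => summable_one_div_kummerZeros_cpow ha hb hj, fun z Ω _ P _ G hG hI => ?_⟩
  set c : ℕ → ℂ := fun k => ((z k : ℂ))⁻¹ with hcdef
  set s : ℂ := -((a : ℂ) / ((a : ℂ) + (b : ℂ))) with hs
  have hc : Summable fun k => ‖c k‖ ^ 2 := by
    have h := z.summable_iff.mpr (summable_kummerZeros_norm_sq ha hb)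
    simpa [Function.comp_def, hcdef] using h
  have hconv : ∀ᵐ ω ∂P, Summable (fun k : ℕ => ((G k ω : ℂ) - 1) / (z k : ℂ))
      (SummationFilter.conditional ℕ) := by
    filter_upwards [ae_exists_tendsto_partialSum hG hI hc] with ω ⟨l, hl⟩
    exact ⟨l, hasSum_conditional_nat_iff.mpr (by simpa only [div_eq_mul_inv] using hl)⟩
  have hlim : ∀ᵐ ω ∂P, Tendsto (fun N => s + ∑ k ∈ Finset.range N, ((G k ω : ℂ) - 1) * c k)
      atTop (𝓝 (kummerZ a b z G ω)) := by
    filter_upwards [hconv] with ω hω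
    have := hasSum_conditional_nat_iff.mp hω.hasSum
    exact (this.const_add s).congr fun N => by simp only [div_eq_mul_inv, hcdef]
  have hmom : ∀ n : ℕ, Integrable (fun ω => kummerZ a b z G ω ^ n) P ∧
      Tendsto (fun N => ∫ ω, (s + ∑ k ∈ Finset.range N, ((G k ω : ℂ) - 1) * c k) ^ n ∂P) atTop
        (𝓝 (hypergeometricBernoulli P a b z G n)) := by
    intro n
    -- An `L²` bound on the `n`-th powers is a bound on absolute moments of order `2 * n`, which is
    -- even.
    obtain ⟨K, hK⟩ := exists_integral_norm_partialSum_le hG hI s hc (n := n * 2) (by simp)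
    have hS := fun N => memLp_partialSum hG s c N
    refine tendsto_integral_of_sq_bounded (fun N => ?_) (K := K) (fun N => ?_) ?_
    · have hi := (hS N (n * 2)).integrable_norm_pow'
      refine (integrable_norm_rpow_iff ((hS N n).1.pow n) (by simp) (by simp)).mp ?_
      simpa [pow_mul] using hi
    · simpa only [norm_pow, ← pow_mul] using hK N
    · filter_upwards [hlim] with ω hω
      exact hω.pow n
  refine ⟨hconv, fun n => (hmom n).1, fun n hn => ?_⟩
  obtain ⟨m, rfl⟩ := Nat.exists_eq_add_of_le' hn
  have hrec : hypergeometricBernoulli P a b z G (m + 1) =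
      s * hypergeometricBernoulli P a b z G m + m ! * ∑ j ∈ Finset.range m,
        hypergeometricBernoulli P a b z G (m - (j + 1)) / ((m - (j + 1))! : ℂ) *
          hypergeometricZeta a b ((j + 2 : ℕ) : ℂ) := by
    -- Both sides of the recurrence for partial sums converge, so it persists in the limit.
    refine tendsto_nhds_unique (hmom (m + 1)).2 (Tendsto.congr
      (fun N => (moment_partialSum_succ hG hI s c N m).symm) ?_)
    refine ((hmom m).2.const_mul s).add (Tendsto.const_mul _ (tendsto_finsetSum _ fun j _ => ?_))
    exact ((hmom _).2.div_const _).mul (tendsto_sum_hypergeometricZeta ha hb z (by omega))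
  have hreindex : ∑ j ∈ Finset.Icc 2 (m + 1),
      hypergeometricBernoulli P a b z G (m + 1 - j) / ((m + 1 - j)! : ℂ) *
        hypergeometricZeta a b (j : ℂ) = ∑ j ∈ Finset.range m,
      hypergeometricBernoulli P a b z G (m - (j + 1)) / ((m - (j + 1))! : ℂ) *
        hypergeometricZeta a b ((j + 2 : ℕ) : ℂ) := by
    rw [← Finset.Ico_add_one_right_eq_Icc, Finset.sum_Ico_eq_sum_range]
    refine Finset.sum_congr (by congr 1) fun j _ => ?_
    rw [show m + 1 - (2 + j) = m - (j + 1) by omega, add_comm 2 j]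
  rw [hreindex, hrec, hs, Nat.add_sub_cancel]
  ring
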